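/- Let $\mathcal G$ be a bidirected $N\times N$ grid network: its nodes are the points of an $N\times N$ square grid, every two adjacent nodes $x,y$ are joined by the two edges $(x,y)$ and $(y,x)$, and all edges have the same capacity $u>0$ and the same transit time $\tau>0$. The sink $s^-$ is a node that does not lie on the boundary of the grid (so it has in-degree $4$), and the source set is $S^+=V\setminus\{s^-\}$. For a source subset $A\subseteq S^+$, the successive shortest path algorithm starts with the zero static flow $\bar f=0$. In step $i=1,2,\dots$ it takes a minimum-cost path $P_i^A$ from $A$ to $s^-$ in the residual network of $\bar f$ (an edge $e$ with $\bar f(e)<u$ has cost $\tau$; the reversal of an edge $e$ with $\bar f(e)>0$ has cost $-\tau$) and adds to $\bar f$ a flow of amount $u$ along it; it stops when there is no such path. Ties are broken by a fixed deterministic rule. Let $p^A$ be the number of paths found. The set $A$ *admits* $(v_1,\dots,v_p)$ if $p^A=p$ and the origins of $P_1^A,\dots,P_p^A$ are $v_1,\dots,v_p$, respectively. Let $|v s^-|$ be the minimum cost of a path from $v$ to $s^-$ in the original network $\mathcal G$ (with the zero flow, costs $\tau$). Call the row and the column through $s^-$ the axes, and divide $V\setminus\{s^-\}$ into five regions: $C_1$: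 nodes off the axes and not on the boundary of the grid; $C_2$: nodes off the axes, on the boundary, but not corners; $C_3$: the corners; $X_1$: nodes on the axes and not on the boundary; $X_2$: nodes on the axes and on the boundary. Say that the tie-breaking rule *keeps the origin* if, for every $A\subseteq S^+$ and every $i$ such that step $i$ takes place, the following holds: if among the minimum-cost paths available in step $i+1$ there is one with the same cost and the same origin as $P_i^A$, then $P_{i+1}^A$ also has that origin. Let $p\in\{1,2,3,4\}$ and $(v_1,\dots,v_p)\in(S^+)^p$, and suppose that some source subset admits $(v_1,\dots,v_p)$. Then, for every tie-breaking rule except where stated otherwise: 1. If $v_1\in C_1$, then $p=4$, $|v_3s^-|\le|v_1s^-|+4\tau$ and $|v_4s^-|\le|v_1s^-|+4\tau$; moreover $v_1=v_2$ if the rule keeps the origin. 2. If $v_1\in C_2$, then $p\ge 3$ and $|v_3s^-|\le|v_1s^-|+4\tau$; moreover $v_1=v_2$ if the rule keeps the origin. 3. If $v_1\in C_3$, then $p\ge2$; moreover $v_1=v_2$ if the rule keeps the origin. 4. If $v_1\in X_1$, then $p=4$, $|v_2s^-|\le|v_1s^-|+2\tau$, $|v_3s^-|\le|v_1s^-|+2\tau$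 and $|v_4s^-|\le|v_1s^-|+8\tau$. 5. If $v_1\in X_2$, then $p\ge3$, $|v_2s^-|\le|v_1s^-|+2\tau$ and $|v_3s^-|\le|v_1s^-|+2\tau$. -/

import Mathlib

/-- A dynamic flow network with uniform edge capacity `cap`, transit times `time`,
a set of sources and a single sink. Parallel edges are allowed. -/
structure FlowNetwork (V E : Type*) where
  tail : E → V
  head : E → V
  cap : ℝ
  cap_pos : 0 < cap
  time : E → ℝ
  time_pos : ∀ e, 0 < time e
  sources : Set V
  sink : V
  sink_notMem : sink ∉ sources

/-- A candidate path: its origin and its list of residual arcs.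
The arc `Sum.inl e` is the edge `e` itself, `Sum.inr e` is the reversal of `e`. -/
structure ArcPath (V E : Type*) where
  origin : V
  arcs : List (E ⊕ E)

namespace FlowNetwork

variable {V E : Type*} (G : FlowNetwork V E)

/-- The node at which a residual arc starts. -/
def arcTail : E ⊕ E → V
  | Sum.inl e => G.tail e
  | Sum.inr e => G.head e

/-- The node at which a residual arc ends. -/
def arcHead : E ⊕ E → V
  | Sum.inl e => G.head e
  | Sum.inr e => G.tail e

/-- The cost of a residual arc: the transit time of the edge, negated for a reversed edge. -/
def arcCost : E ⊕ E → ℝ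
  | Sum.inl e => G.time e
  | Sum.inr e => -G.time e

/-- The arc has positive residual capacity with respect to the static flow `f`
(`cap - f e` for the edge `e`, `f e` for its reversal). -/
def Residual (f : E → ℝ) : E ⊕ E → Prop
  | Sum.inl e => f e < G.cap
  | Sum.inr e => 0 < f e

/-- The list of arcs is a walk from `v` to the sink in the residual network of `f`. -/
def IsWalk (f : E → ℝ) : V → List (E ⊕ E) → Prop
  | v, [] => v = G.sink
  | v, a :: l => G.Residual f a ∧ G.arcTail a = v ∧ IsWalk f (G.arcHead a) l

/-- `P` is a path (no repeated node) from its origin to the sink in the residual network of `f`. -/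
def IsPath (f : E → ℝ) (P : ArcPath V E) : Prop :=
  G.IsWalk f P.origin P.arcs ∧ (P.origin :: P.arcs.map G.arcHead).Nodup

/-- The cost `|P|`. -/
def cost (P : ArcPath V E) : ℝ := (P.arcs.map G.arcCost).sum

/-- `P` is a path from the set `A` to the sink in the residual network of `f`. -/
def IsPathFrom (A : Set V) (f : E → ℝ) (P : ArcPath V E) : Prop :=
  P.origin ∈ A ∧ G.IsPath f P

/-- `P` is a minimum-cost path from `A` to the sink in the residual network of `f`. -/
def IsMinPathFrom (A : Set V) (f : E → ℝ) (P : ArcPath V E) : Prop :=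
  G.IsPathFrom A f P ∧ ∀ Q, G.IsPathFrom A f Q → G.cost P ≤ G.cost Q

/-- `|v s⁻|`: the minimum cost of a path from `v` to the sink in the static network
(the residual network of the zero flow). -/
noncomputable def distToSink (v : V) : ℝ :=
  sInf {c | ∃ P : ArcPath V E, P.origin = v ∧ G.IsPath 0 P ∧ G.cost P = c}

open Classical in
/-- Add to `f` a static flow of amount `cap` along `P`. -/
noncomputable def augment (f : E → ℝ) (P : ArcPath V E) : E → ℝ := fun e =>
  f e + (if Sum.inl e ∈ P.arcs then G.cap else 0) - (if Sum.inr e ∈ P.arcs then G.cap else 0)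

/-- The static flow after augmenting along a list of paths (latest path first). -/
noncomputable def flowOf : List (ArcPath V E) → E → ℝ
  | [] => 0
  | P :: H => G.augment (flowOf H) P

/-- A deterministic way of resolving ties in the successive shortest path algorithm: given the
source subset `A` and the paths chosen so far (latest first), it selects a minimum-cost path from
`A` to the sink in the current residual network, whenever there is a path at all. -/
structure TieBreakingRule where
  choose : Set V → List (ArcPath V E) → ArcPath V E
  choose_min : ∀ (A : Set V) (H : List (ArcPath V E)),
    (∃ P, G.IsPathFrom A (G.flowOf H) P) → G.IsMinPathFrom A (G.flowOf H) (choose A H)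

namespace TieBreakingRule

variable {G} (ρ : G.TieBreakingRule)

/-- The paths chosen in the first `i` steps on input `A`, latest first. -/
def history (A : Set V) : ℕ → List (ArcPath V E)
  | 0 => []
  | i + 1 => ρ.choose A (history A i) :: history A i

/-- The path chosen in step `i + 1` on input `A` (meaningful if that step takes place). -/
def path (A : Set V) (i : ℕ) : ArcPath V E := ρ.choose A (ρ.history A i)

/-- The static flow after the first `i` steps on input `A`. -/
noncomputable def flow (A : Set V) (i : ℕ) : E → ℝ := G.flowOf (ρ.history A i)

/-- On input `A`, the algorithm finds exactly `p` paths: `p^A = p`. -/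
def FindsExactly (A : Set V) (p : ℕ) : Prop :=
  (∀ i < p, ∃ P, G.IsPathFrom A (ρ.flow A i) P) ∧ ¬ ∃ P, G.IsPathFrom A (ρ.flow A p) P

/-- The source subset `A` admits `(v_1, …, v_p)`: the algorithm finds exactly `p` paths on input
`A` and their origins are `v_1, …, v_p` in this order. -/
def Admits (A : Set V) {p : ℕ} (v : Fin p → V) : Prop :=
  ρ.FindsExactly A p ∧ ∀ i : Fin p, (ρ.path A i).origin = v i

/-- The rule does not change the origin without need: if, on some input `A`, steps `i + 1` and
`i + 2` take place and among the minimum-cost paths in step `i + 2` there is one with the same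
cost and the same origin as the path of step `i + 1`, then the path chosen in step `i + 2` has
that origin as well. -/
def KeepsOrigin : Prop :=
  ∀ A ⊆ G.sources, ∀ i : ℕ, (∃ P, G.IsPathFrom A (ρ.flow A i) P) →
    (∃ Q, G.IsMinPathFrom A (ρ.flow A (i + 1)) Q ∧
      Q.origin = (ρ.path A i).origin ∧ G.cost Q = G.cost (ρ.path A i)) →
    (ρ.path A (i + 1)).origin = (ρ.path A i).origin

end TieBreakingRule

end FlowNetwork

/-- The square grid graph with `N × N` nodes. -/
def gridGraph (N : ℕ) : SimpleGraph (Fin N × Fin N) :=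
  (SimpleGraph.pathGraph N).boxProd (SimpleGraph.pathGraph N)

/-- The bidirected grid network: its edges are the two orientations of each grid edge, all with
capacity `u` and transit time `τ`; every node other than the sink is a source. -/
def gridNetwork (N : ℕ) (s : Fin N × Fin N) (u τ : ℝ) (hu : 0 < u) (hτ : 0 < τ) :
    FlowNetwork (Fin N × Fin N) (gridGraph N).Dart where
  tail e := e.fst
  head e := e.snd
  cap := u
  cap_pos := hu
  time _ := τ
  time_pos _ := hτ
  sources := {s}ᶜ
  sink := s
  sink_notMem := by simp

namespace Grid

variable {N : ℕ}

/-- The coordinate is extreme: first or last. -/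
def IsEnd (i : Fin N) : Prop := i.val = 0 ∨ i.val + 1 = N

/-- The node lies in the row or in the column of the sink `s`. -/
def OnAxis (s v : Fin N × Fin N) : Prop := v.1 = s.1 ∨ v.2 = s.2

/-- Nodes off the axes through `s` and not on the boundary of the grid. -/
def C1 (s : Fin N × Fin N) : Set (Fin N × Fin N) :=
  {v | ¬ OnAxis s v ∧ ¬ IsEnd v.1 ∧ ¬ IsEnd v.2}

/-- Nodes off the axes through `s`, on the boundary of the grid, but not corners. -/
def C2 (s : Fin N × Fin N) : Set (Fin N × Fin N) :=
  {v | ¬ OnAxis s v ∧ Xor (IsEnd v.1) (IsEnd v.2)}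

/-- Corners of the grid, off the axes through `s`. -/
def C3 (s : Fin N × Fin N) : Set (Fin N × Fin N) :=
  {v | ¬ OnAxis s v ∧ IsEnd v.1 ∧ IsEnd v.2}

/-- Nodes other than `s` on the axes through `s`, not on the boundary of the grid. -/
def X1 (s : Fin N × Fin N) : Set (Fin N × Fin N) :=
  {v | v ≠ s ∧ OnAxis s v ∧ ¬ IsEnd v.1 ∧ ¬ IsEnd v.2}

/-- Nodes other than `s` on the axes through `s`, on the boundary of the grid. -/
def X2 (s : Fin N × Fin N) : Set (Fin N × Fin N) :=
  {v | v ≠ s ∧ OnAxis s v ∧ (IsEnd v.1 ∨ IsEnd v.2)}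

end Grid

/-! The origin `v₁` of the first path lies in `A` and stays available in every later step, so cheap
residual paths from `v₁` bound the later costs from above. They come from linear programming
duality. Let an edge set `S` carry `k` units from `v₁` to the sink, and let a potential `h` drop by
at least the transit time on `S` and by at most the transit time elsewhere. Given a flow of value
less than `k` capacities, follow residual arcs whose cost is at most the drop of `h`. If the sink
were not reached, every edge of `S` leaving the reached set would be saturated and every entering
edge outside `S` would be empty, so at least `k` capacities would cross this cut. Hence
`exists_walk_of_certificate`: some residual walk costs at most the potential difference, wherever
the earlier paths started.

From below, augmenting along shortest paths allows feasible potentials to be raised only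
(`Feasible.exists_augment`), so each path costs at least the original distance of its origin.
`Certified.admits` combines the two bounds.

In the grid the certificates are explicit. Off the axes there are two shortest L-shaped paths, and
each free side beyond the node gives a detour with four more edges. On an axis there are the
straight path, its two parallels with two more edges, and, away from the boundary, a detour with
eight more. Off the axes the second path is as cheap as the first, which produces the tie that a
rule keeping the origin resolves in favour of `v₁`. -/

namespace FlowNetwork

/-! ### Feasible potentials and residual walks -/

variable {V E : Type*} (G : FlowNetwork V E)

/-- The potential `π` certifies nonnegative reduced costs of all residual arcs of `f`. -/
def Feasible (f : E → ℝ) (π : V → ℝ) : Prop :=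
  ∀ a, G.Residual f a → π (G.arcTail a) ≤ G.arcCost a + π (G.arcHead a)

variable {G} {f : E → ℝ} {π : V → ℝ}

theorem Feasible.le_walk (hπ : G.Feasible f π) {l : List (E ⊕ E)} :
    ∀ {x : V}, G.IsWalk f x l → π x ≤ (l.map G.arcCost).sum + π G.sink := by
  induction l with
  | nil => intro x h; simp [IsWalk] at h; simp [h]
  | cons a l ih =>
    rintro x ⟨ha, rfl, hl⟩
    have h1 := hπ a ha
    have h2 := ih hl
    simp only [List.map_cons, List.sum_cons]
    linarith

theorem IsWalk.of_append {pre suf : List (E ⊕ E)} {a : E ⊕ E} :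
    ∀ {x : V}, G.IsWalk f x (pre ++ a :: suf) → G.IsWalk f (G.arcTail a) (a :: suf) := by
  induction pre with
  | nil => rintro x ⟨ha, h, hl⟩; exact ⟨ha, rfl, hl⟩
  | cons b pre ih => rintro x ⟨_, _, hl⟩; exact ih hl

theorem IsWalk.residual_of_mem {l : List (E ⊕ E)} {a : E ⊕ E} {x : V} (h : G.IsWalk f x l)
    (ha : a ∈ l) : G.Residual f a := by
  obtain ⟨pre, suf, rfl⟩ := List.append_of_mem ha
  exact h.of_append.1

theorem IsWalk.replace_suffix {pre suf l : List (E ⊕ E)} {a : E ⊕ E} :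
    ∀ {x : V}, G.IsWalk f x (pre ++ a :: suf) → G.IsWalk f (G.arcTail a) l →
      G.IsWalk f x (pre ++ l) := by
  induction pre with
  | nil => rintro x ⟨ha, h, _⟩ h'; exact h ▸ h'
  | cons b pre ih => rintro x ⟨hb, hx, hl⟩ h'; exact ⟨hb, hx, ih hl h'⟩

theorem Feasible.le_prefix (hπ : G.Feasible f π) {pre suf : List (E ⊕ E)} {a : E ⊕ E} :
    ∀ {x : V}, G.IsWalk f x (pre ++ a :: suf) →
      π x ≤ (pre.map G.arcCost).sum + π (G.arcTail a) := by
  induction pre with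
  | nil => rintro x ⟨ha, h, _⟩; simp [h]
  | cons b pre ih =>
    rintro x ⟨hb, rfl, hl⟩
    have h1 := hπ b hb
    have h2 := ih hl
    simp only [List.map_cons, List.sum_cons]
    linarith

/-- By telescoping, the part of the path cut off before `x` costs at least `π y - π x`. Applied when
an arc from `x` to `y` closes a cycle, this lets the cycle be removed without raising the cost. -/
theorem Feasible.exists_suffix (hπ : G.Feasible f π) {x : V} {l : List (E ⊕ E)} :
    ∀ {y : V}, G.IsWalk f y l → (y :: l.map G.arcHead).Nodup → x ∈ y :: l.map G.arcHead →
      ∃ l', G.IsWalk f x l' ∧ (x :: l'.map G.arcHead).Nodup ∧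
        π y + (l'.map G.arcCost).sum ≤ (l.map G.arcCost).sum + π x := by
  induction l with
  | nil =>
    intro y h hn hx
    simp at hx
    subst hx
    exact ⟨[], h, hn, by simp⟩
  | cons a l ih =>
    intro y h hn hx
    by_cases hxy : x = y
    · subst hxy
      exact ⟨a :: l, h, hn, by linarith⟩
    · obtain ⟨ha, rfl, hl⟩ := h
      have hx' : x ∈ G.arcHead a :: l.map G.arcHead := by
        simpa [hxy] using hx
      obtain ⟨l', h1, h2, h3⟩ := ih hl (List.nodup_cons.1 hn).2 hx'
      refine ⟨l', h1, h2, ?_⟩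
      have := hπ a ha
      simp only [List.map_cons, List.sum_cons]
      linarith

/-- Every residual walk to the sink can be shortened to a path that is not more expensive. -/
theorem Feasible.exists_path (hπ : G.Feasible f π) {l : List (E ⊕ E)} :
    ∀ {x : V}, G.IsWalk f x l →
      ∃ P : ArcPath V E, P.origin = x ∧ G.IsPath f P ∧ G.cost P ≤ (l.map G.arcCost).sum := by
  induction l with
  | nil => intro x h; exact ⟨⟨x, []⟩, rfl, ⟨h, by simp⟩, by simp [cost]⟩
  | cons a l ih =>
    rintro x ⟨ha, rfl, hl⟩
    obtain ⟨⟨y, l'⟩, rfl, ⟨hw, hn⟩, hc⟩ := ih hl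
    simp only [cost] at hw hn hc
    by_cases hx : G.arcTail a ∈ G.arcHead a :: l'.map G.arcHead
    · obtain ⟨l'', h1, h2, h3⟩ := hπ.exists_suffix hw hn hx
      refine ⟨⟨_, l''⟩, rfl, ⟨h1, h2⟩, ?_⟩
      have := hπ a ha
      simp only [cost, List.map_cons, List.sum_cons]
      linarith
    · refine ⟨⟨_, a :: l'⟩, rfl, ⟨⟨ha, rfl, hw⟩, ?_⟩, ?_⟩
      · rw [List.map_cons]
        exact List.nodup_cons.2 ⟨hx, hn⟩
      · simp only [cost, List.map_cons, List.sum_cons]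
        linarith

theorem IsMinPathFrom.cost_le_walk {A : Set V} {P : ArcPath V E} (hP : G.IsMinPathFrom A f P)
    (hπ : G.Feasible f π) {x : V} (hx : x ∈ A) {l : List (E ⊕ E)} (hl : G.IsWalk f x l) :
    G.cost P ≤ (l.map G.arcCost).sum := by
  obtain ⟨Q, hQ, hQp, hc⟩ := hπ.exists_path hl
  exact (hP.2 Q ⟨hQ ▸ hx, hQp⟩).trans hc

/-- Potentials can be raised so that they certify the flow augmented along a shortest path. -/
theorem Feasible.exists_augment (hπ : G.Feasible f π) (hs : π G.sink = 0) {A : Set V}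
    {P : ArcPath V E} (hP : G.IsMinPathFrom A f P) :
    ∃ π' : V → ℝ, G.Feasible (G.augment f P) π' ∧ π' G.sink = 0 ∧ ∀ x, π x ≤ π' x := by
  obtain ⟨v, L⟩ := P
  have hv : v ∈ A := hP.1.1
  have hw : G.IsWalk f v L := hP.1.2.1
  have hmin : ∀ l, G.IsWalk f v l → (L.map G.arcCost).sum ≤ (l.map G.arcCost).sum :=
    fun l hl => hP.cost_le_walk hπ hv hl
  set M : ℝ := (L.map G.arcCost).sum - π v with hM
  have hM0 : 0 ≤ M := by have := hπ.le_walk hw; rw [hM]; linarith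
  -- The new potential is the residual distance to the sink, truncated at `π x + M` so that it is
  -- finite where the sink is unreachable. `M` is the reduced cost of the whole path; as prefixes
  -- have nonnegative reduced cost, the truncation does not bite along the path.
  let D : V → Set ℝ := fun x =>
    insert (π x + M) {c | ∃ l, G.IsWalk f x l ∧ (l.map G.arcCost).sum = c}
  have hlow : ∀ x, ∀ c ∈ D x, π x ≤ c := by
    rintro x c (rfl | ⟨l, hl, rfl⟩)
    · linarith
    · have := hπ.le_walk hl; linarith
  have hbdd : ∀ x, BddBelow (D x) := fun x => ⟨π x, hlow x⟩
  have hne : ∀ x, (D x).Nonempty := fun x => ⟨_, Set.mem_insert _ _⟩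
  have hfeas : G.Feasible f (fun x => sInf (D x)) := by
    intro a ha
    have : sInf (D (G.arcTail a)) - G.arcCost a ≤ sInf (D (G.arcHead a)) := by
      apply le_csInf (hne _)
      rintro c (rfl | ⟨l, hl, rfl⟩)
      · have h1 := csInf_le (hbdd (G.arcTail a)) (Set.mem_insert _ _)
        have h2 := hπ a ha
        linarith
      · have h1 : sInf (D (G.arcTail a)) ≤ ((a :: l).map G.arcCost).sum :=
          csInf_le (hbdd (G.arcTail a)) (Set.mem_insert_of_mem _ ⟨a :: l, ⟨ha, rfl, hl⟩, rfl⟩)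
        simp only [List.map_cons, List.sum_cons] at h1
        linarith
    linarith
  have htight : ∀ a ∈ L, G.arcCost a + sInf (D (G.arcHead a)) ≤ sInf (D (G.arcTail a)) := by
    intro a ha
    obtain ⟨pre, suf, rfl⟩ := List.append_of_mem ha
    have hsuf := hw.of_append
    have h1 : sInf (D (G.arcHead a)) ≤ (suf.map G.arcCost).sum :=
      csInf_le (hbdd _) (Set.mem_insert_of_mem _ ⟨suf, hsuf.2.2, rfl⟩)
    refine le_csInf (hne _) ?_
    rintro c (rfl | ⟨l, hl, rfl⟩)
    · have h2 := hπ.le_prefix hw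
      simp only [List.map_append, List.map_cons, List.sum_append, List.sum_cons] at hM
      linarith
    · have h2 := hmin _ (hw.replace_suffix hl)
      simp only [List.map_append, List.map_cons, List.sum_append, List.sum_cons] at h2
      linarith
  have hcap := G.cap_pos
  refine ⟨fun x => sInf (D x), ?_, ?_, fun x => le_csInf (hne x) (hlow x)⟩
  -- An arc that is residual after the augmentation either was residual before or reverses an arc of
  -- the path, where the new potential is tight.
  · rintro (e | e) he
    · by_cases hr : Sum.inr e ∈ L
      · have := htight _ hr
        simp only [arcCost, arcHead, arcTail] at this ⊢
        linarith
      · refine hfeas (Sum.inl e) ?_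
        simp only [Residual, augment, hr, if_false] at he ⊢
        split_ifs at he <;> linarith
    · by_cases hr : Sum.inl e ∈ L
      · have := htight _ hr
        simp only [arcCost, arcHead, arcTail] at this ⊢
        linarith
      · refine hfeas (Sum.inr e) ?_
        simp only [Residual, augment, hr, if_false] at he ⊢
        split_ifs at he <;> linarith
  · apply le_antisymm
    · exact csInf_le (hbdd _) (Set.mem_insert_of_mem _ ⟨[], rfl, by simp⟩)
    · exact le_csInf (hne _) fun c hc => hs ▸ hlow _ c hc

/-! ### Flow across cuts and the duality argument -/

/-- The drop of the indicator of `X` along an arc from `x` to `y`. -/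
noncomputable def drop (X : Set V) (x y : V) : ℝ := X.indicator 1 x - X.indicator 1 y

variable (G) in
/-- The net outflow of `f` from the node set `X`. -/
noncomputable def net [Fintype E] (X : Set V) (f : E → ℝ) : ℝ :=
  ∑ e, f e * drop X (G.tail e) (G.head e)

theorem IsWalk.sum_drop {X : Set V} {l : List (E ⊕ E)} :
    ∀ {x : V}, G.IsWalk f x l →
      (l.map fun a => drop X (G.arcTail a) (G.arcHead a)).sum = drop X x G.sink := by
  induction l with
  | nil => intro x h; simp [IsWalk] at h; simp [h, drop]
  | cons a l ih =>
    rintro x ⟨_, rfl, hl⟩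
    rw [List.map_cons, List.sum_cons, ih hl]
    simp only [drop]
    ring

theorem net_augment [Fintype E] {X : Set V} {P : ArcPath V E} (hP : G.IsPath f P) :
    G.net X (G.augment f P) = G.net X f + G.cap * drop X P.origin G.sink := by
  classical
  -- `augment` tests membership instead of counting occurrences, so its effect is the sum over the
  -- arc list only because no arc is repeated.
  have hnd : P.arcs.Nodup := List.Nodup.of_map _ (List.nodup_cons.1 hP.2).2
  rw [← hP.1.sum_drop, ← List.sum_toFinset _ hnd, ← Finset.univ_inter P.arcs.toFinset,
    ← Finset.sum_ite_mem, Fintype.sum_sum_type, mul_add, Finset.mul_sum, Finset.mul_sum, net, net,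
    ← Finset.sum_add_distrib, ← Finset.sum_add_distrib]
  refine Finset.sum_congr rfl fun e _ => ?_
  simp only [augment, List.mem_toFinset, arcTail, arcHead, drop]
  split_ifs <;> ring

/-- Key lemma: if the edge set `S` carries `k` units from `v` to the sink and `h` is a potential
certifying that `S` is optimal, then any flow of value less than `k` leaves a residual walk from
`v` to the sink whose cost is bounded by the potential difference. -/
theorem exists_walk_of_certificate [Fintype E] {v : V} {S : Set E} {h : V → ℝ} {i k : ℕ}
    (hS : ∀ e ∈ S, G.time e ≤ h (G.tail e) - h (G.head e))
    (hS' : ∀ e ∉ S, h (G.tail e) - h (G.head e) ≤ G.time e)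
    (hnet : ∀ X : Set V, v ∈ X → G.sink ∉ X → (k : ℝ) ≤ G.net X (S.indicator 1))
    (hf0 : ∀ e, 0 ≤ f e) (hf1 : ∀ e, f e ≤ G.cap)
    (hf : ∀ X : Set V, G.sink ∉ X → G.net X f ≤ i * G.cap) (hik : i < k) :
    ∃ l, G.IsWalk f v l ∧ (l.map G.arcCost).sum ≤ h v - h G.sink := by
  have hcap := G.cap_pos
  let T : E ⊕ E → Prop := fun a => G.Residual f a ∧ G.arcCost a ≤ h (G.arcTail a) - h (G.arcHead a)
  let R : V → V → Prop := fun x y => ∃ a, T a ∧ G.arcTail a = x ∧ G.arcHead a = y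
  by_cases hsink : Relation.ReflTransGen R v G.sink
  · clear hnet
    induction hsink using Relation.ReflTransGen.head_induction_on with
    | refl => exact ⟨[], rfl, by simp⟩
    | head hxy _ ih =>
      obtain ⟨a, ⟨ha, hc⟩, rfl, rfl⟩ := hxy
      obtain ⟨l, hl, hlc⟩ := ih
      refine ⟨a :: l, ⟨ha, rfl, hl⟩, ?_⟩
      simp only [List.map_cons, List.sum_cons]
      linarith
  · exfalso
    set X : Set V := {x | Relation.ReflTransGen R v x} with hX
    have h1 := hnet X Relation.ReflTransGen.refl hsink
    have h2 := hf X hsink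
    have hclosed : ∀ a, T a → G.arcTail a ∈ X → G.arcHead a ∈ X :=
      fun a ha hx => Relation.ReflTransGen.tail hx ⟨a, ha, rfl, rfl⟩
    -- Edge by edge across the cut: leaving edges of `S` are saturated, entering edges outside `S`
    -- are empty, and the other two cases follow from the capacity bounds.
    have h3 : G.cap * G.net X (S.indicator 1) ≤ G.net X f := by
      rw [net, net, Finset.mul_sum]
      refine Finset.sum_le_sum fun e _ => ?_
      have hl := hclosed (Sum.inl e)
      have hr := hclosed (Sum.inr e)
      have he0 := hf0 e
      have he1 := hf1 e
      simp only [T, Residual, arcCost, arcTail, arcHead] at hl hr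
      by_cases ht : G.tail e ∈ X <;> by_cases hh : G.head e ∈ X <;> by_cases heS : e ∈ S <;>
        simp only [drop, ht, hh, heS, Set.indicator_of_mem, Set.indicator_of_notMem,
          not_false_eq_true, Pi.one_apply, sub_self, sub_zero, zero_sub, mul_zero, mul_one,
          mul_neg, neg_zero, le_refl, forall_const, implies_true, imp_false] at hl hr ⊢
      · have := hS e heS
        have : ¬ f e < G.cap := fun hlt => hl ⟨hlt, this⟩
        linarith
      · exact he0
      · linarith
      · have := hS' e heS
        have : ¬ 0 < f e := fun hlt => hr ⟨hlt, by linarith⟩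
        linarith
    have h4 : (i : ℝ) + 1 ≤ k := by exact_mod_cast hik
    nlinarith

/-! ### Invariants of the algorithm -/

namespace TieBreakingRule

variable (ρ : G.TieBreakingRule)

theorem isMinPathFrom_path {A : Set V} {i : ℕ} (h : ∃ P, G.IsPathFrom A (ρ.flow A i) P) :
    G.IsMinPathFrom A (ρ.flow A i) (ρ.path A i) := ρ.choose_min A _ h

/-- With values in `{0, cap}`, an edge is residual only at `0` and its reversal only at `cap`, so
adding or removing `cap` stays in this set. This supplies the capacity bounds of the duality
argument. -/
theorem flow_eq_zero_or_cap {A : Set V} {i : ℕ}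
    (h : ∀ j < i, ∃ P, G.IsPathFrom A (ρ.flow A j) P) (e : E) :
    ρ.flow A i e = 0 ∨ ρ.flow A i e = G.cap := by
  induction i with
  | zero => exact Or.inl rfl
  | succ i ih =>
    have hP := (ρ.isMinPathFrom_path (h i i.lt_succ_self)).1.2.1
    have hl := fun ha => hP.residual_of_mem (a := Sum.inl e) ha
    have hr := fun ha => hP.residual_of_mem (a := Sum.inr e) ha
    have hcap := G.cap_pos
    have ih := ih fun j hj => h j (by omega)
    change G.augment (ρ.flow A i) (ρ.path A i) e = 0 ∨ G.augment (ρ.flow A i) (ρ.path A i) e = _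
    simp only [Residual] at hl hr
    simp only [augment]
    rcases ih with ih | ih <;> rw [ih] at hl hr ⊢ <;> split_ifs with h1 h2 h2 <;> simp_all

theorem net_flow_le [Fintype E] {A : Set V} {i : ℕ}
    (h : ∀ j < i, ∃ P, G.IsPathFrom A (ρ.flow A j) P) {X : Set V} (hX : G.sink ∉ X) :
    G.net X (ρ.flow A i) ≤ i * G.cap := by
  induction i with
  | zero => simp [flow, history, flowOf, net]
  | succ i ih =>
    have hP := (ρ.isMinPathFrom_path (h i i.lt_succ_self)).1.2
    change G.net X (G.augment (ρ.flow A i) (ρ.path A i)) ≤ _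
    rw [net_augment hP]
    have ih := ih fun j hj => h j (by omega)
    have hcap := G.cap_pos
    have : drop X (ρ.path A i).origin G.sink ≤ 1 := by
      by_cases hx : (ρ.path A i).origin ∈ X <;> simp [drop, hX, hx]
    push_cast
    nlinarith

theorem exists_feasible {A : Set V} {i : ℕ} {π : V → ℝ} (hπ : G.Feasible 0 π)
    (hs : π G.sink = 0) (h : ∀ j < i, ∃ P, G.IsPathFrom A (ρ.flow A j) P) :
    ∃ π', G.Feasible (ρ.flow A i) π' ∧ π' G.sink = 0 ∧ ∀ x, π x ≤ π' x := by
  induction i with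
  | zero => exact ⟨π, hπ, hs, fun _ => le_rfl⟩
  | succ i ih =>
    obtain ⟨π', h1, h2, h3⟩ := ih fun j hj => h j (by omega)
    obtain ⟨π'', h4, h5, h6⟩ := h1.exists_augment h2 (ρ.isMinPathFrom_path (h i i.lt_succ_self))
    exact ⟨π'', h4, h5, fun x => (h3 x).trans (h6 x)⟩

/-- The origin of the path found in any step is no further from the sink, measured by a potential
of the original network, than the cost of that path. -/
theorem potential_origin_le_cost {A : Set V} {i : ℕ} {π : V → ℝ} (hπ : G.Feasible 0 π)
    (hs : π G.sink = 0) (h : ∀ j ≤ i, ∃ P, G.IsPathFrom A (ρ.flow A j) P) :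
    π (ρ.path A i).origin ≤ G.cost (ρ.path A i) := by
  obtain ⟨π', h1, h2, h3⟩ := ρ.exists_feasible hπ hs fun j hj => h j (le_of_lt hj)
  have := h1.le_walk (ρ.isMinPathFrom_path (h i le_rfl)).1.2.1
  rw [h2, add_zero] at this
  exact (h3 _).trans this

end TieBreakingRule

/-! ### Consequences of a certificate -/

variable (G) in
/-- `k` units can be sent from `v` to the sink along the edge set `S`, and a potential certifies
that the last of these units costs at most `c`. -/
def Certified [Fintype E] (v : V) (k : ℕ) (c : ℝ) : Prop :=
  ∃ (S : Set E) (h : V → ℝ), (∀ e ∈ S, G.time e ≤ h (G.tail e) - h (G.head e)) ∧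
    (∀ e ∉ S, h (G.tail e) - h (G.head e) ≤ G.time e) ∧
    (∀ X : Set V, v ∈ X → G.sink ∉ X → (k : ℝ) ≤ G.net X (S.indicator 1)) ∧
    h v - h G.sink ≤ c

theorem Certified.exists_path [Fintype E] {v : V} {k : ℕ} {c : ℝ} (hc : G.Certified v k c)
    (ρ : G.TieBreakingRule) {A : Set V} {i : ℕ} (hik : i < k)
    (h : ∀ j < i, ∃ P, G.IsPathFrom A (ρ.flow A j) P) :
    ∃ P : ArcPath V E, P.origin = v ∧ G.IsPath (ρ.flow A i) P ∧ G.cost P ≤ c := by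
  obtain ⟨S, g, hS, hS', hnet, hg⟩ := hc
  have hcap := G.cap_pos
  have h01 := ρ.flow_eq_zero_or_cap h
  obtain ⟨l, hl, hlc⟩ := exists_walk_of_certificate (f := ρ.flow A i) (i := i) hS hS' hnet
    (fun e => by rcases h01 e with h | h <;> rw [h]; exact hcap.le)
    (fun e => by rcases h01 e with h | h <;> rw [h]; exact hcap.le)
    (fun X hX => ρ.net_flow_le h hX) hik
  -- Transit times are positive, so the zero potential can start the induction; the potential it
  -- yields excludes negative cycles, and the walk shortens to a path.
  have h0 : G.Feasible 0 (fun _ => 0) := by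
    rintro (e | e) he
    · simpa [arcCost] using (G.time_pos e).le
    · simp [Residual] at he
  obtain ⟨π, hπ, -, -⟩ := ρ.exists_feasible h0 rfl h
  obtain ⟨P, hP, hP', hPc⟩ := hπ.exists_path hl
  exact ⟨P, hP, hP', hPc.trans (hlc.trans hg)⟩

/-- Before `k` steps are done a path from `v₁` of cost at most `c` remains, so the algorithm cannot
stop and its next path costs at most `c`; that cost is in turn at least the potential of the chosen
origin. -/
theorem Certified.admits [Fintype E] {ρ : G.TieBreakingRule} {A : Set V} {p : ℕ} {v : Fin p → V}
    (hadm : ρ.Admits A v) (hp : 0 < p) {k : ℕ} {c : ℝ} (hc : G.Certified (v ⟨0, hp⟩) k c)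
    (hπ : G.Feasible 0 π) (hs : π G.sink = 0) :
    k ≤ p ∧ ∀ i (hi : i < p), i < k → π (v ⟨i, hi⟩) ≤ c := by
  obtain ⟨⟨hex, hnone⟩, horig⟩ := hadm
  have hv : v ⟨0, hp⟩ ∈ A := horig ⟨0, hp⟩ ▸ (ρ.isMinPathFrom_path (hex 0 hp)).1.1
  refine ⟨?_, fun i hi hik => ?_⟩
  · by_contra! hlt
    obtain ⟨P, hP, hP', -⟩ := hc.exists_path ρ hlt hex
    exact hnone ⟨P, hP ▸ hv, hP'⟩
  · obtain ⟨P, hP, hP', hPc⟩ := hc.exists_path ρ hik fun j hj => hex j (hj.trans hi)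
    have h1 := (ρ.isMinPathFrom_path (hex i hi)).2 P ⟨hP ▸ hv, hP'⟩
    have h2 := ρ.potential_origin_le_cost (A := A) (i := i) hπ hs
      fun j hj => hex j (lt_of_le_of_lt hj hi)
    rw [horig ⟨i, hi⟩] at h2
    linarith

/-- If two units can be sent from the first origin to the sink without raising the cost, then a
rule that keeps the origin uses that origin twice. -/
theorem Certified.keepsOrigin [Fintype E] {ρ : G.TieBreakingRule} (hρ : ρ.KeepsOrigin) {A : Set V}
    (hA : A ⊆ G.sources) {p : ℕ} {v : Fin p → V} (hadm : ρ.Admits A v) (hp : 1 < p)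
    (hc : G.Certified (v ⟨0, by omega⟩) 2 (π (v ⟨0, by omega⟩)))
    (hπ : G.Feasible 0 π) (hs : π G.sink = 0)
    (hπ' : ∀ x, ∃ P : ArcPath V E, P.origin = x ∧ G.IsPath 0 P ∧ G.cost P ≤ π x) :
    v ⟨0, by omega⟩ = v ⟨1, hp⟩ := by
  obtain ⟨⟨hex, -⟩, horig⟩ := hadm
  have horig0 := horig ⟨0, by omega⟩
  have horig1 := horig ⟨1, hp⟩
  have hmin0 := ρ.isMinPathFrom_path (hex 0 (by omega))
  have hmin1 := ρ.isMinPathFrom_path (hex 1 hp)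
  dsimp only at horig0 horig1
  rw [← horig0] at hc ⊢
  rw [← horig1]
  obtain ⟨Q, hQ, hQ', hQc⟩ := hc.exists_path ρ (i := 1) (by omega) fun j hj => hex j (by omega)
  have hQA : G.IsPathFrom A (ρ.flow A 1) Q := ⟨hQ ▸ hmin0.1.1, hQ'⟩
  obtain ⟨R, hR, hR', hRc⟩ := hπ' (ρ.path A 1).origin
  have h1 : G.cost (ρ.path A 0) ≤ G.cost R := hmin0.2 R ⟨hR ▸ hmin1.1.1, hR'⟩
  have h2 := ρ.potential_origin_le_cost (A := A) (i := 0) hπ hs fun j hj => hex j (by omega)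
  have h3 := ρ.potential_origin_le_cost (A := A) (i := 1) hπ hs fun j hj => hex j (by omega)
  have h4 := hmin1.2 Q hQA
  -- The bounds close up: cost of `Q` ≤ `π v₁` ≤ first cost ≤ `π` of the second origin ≤ second cost
  -- ≤ cost of `Q`. All are equal, so `Q` is a tie.
  refine (hρ A hA 0 (hex 0 (by omega)) ⟨Q, ⟨hQA, fun Q' hQ' => ?_⟩, hQ, ?_⟩).symm
  · have := hmin1.2 Q' hQ'
    linarith
  · linarith

theorem distToSink_eq (hπ : G.Feasible 0 π) (hs : π G.sink = 0)
    (hπ' : ∀ x, ∃ P : ArcPath V E, P.origin = x ∧ G.IsPath 0 P ∧ G.cost P ≤ π x) (x : V) :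
    G.distToSink x = π x := by
  have hlow : ∀ c ∈ {c | ∃ P : ArcPath V E, P.origin = x ∧ G.IsPath 0 P ∧ G.cost P = c},
      π x ≤ c := by
    rintro c ⟨P, rfl, hP, rfl⟩
    have := hπ.le_walk hP.1
    rwa [hs, add_zero] at this
  obtain ⟨P, hP, hP', hPc⟩ := hπ' x
  exact le_antisymm ((csInf_le ⟨_, hlow⟩ ⟨P, hP, hP', rfl⟩).trans hPc)
    (le_csInf ⟨_, P, hP, hP', rfl⟩ hlow)

end FlowNetwork

/-! ### Coordinates centred at the sink and their symmetries -/

namespace Grid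

open FlowNetwork

variable {N : ℕ} {s : Fin N × Fin N}

/-- `(x', y')` is one of the four neighbours of `(x, y)` in the integer grid. -/
def UnitStep (x y x' y' : ℤ) : Prop :=
  (x = x' ∧ (y = y' + 1 ∨ y' = y + 1)) ∨ (y = y' ∧ (x = x' + 1 ∨ x' = x + 1))

/-- The edges of the straight segment leading left from `(a, b)` to `(a', b)`. -/
def Left (a a' b x y x' y' : ℤ) : Prop := y = b ∧ y' = b ∧ x' + 1 = x ∧ x ≤ a ∧ a' ≤ x'

/-- The edges of the straight segment leading right from `(a, b)` to `(a', b)`. -/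
def Right (a a' b x y x' y' : ℤ) : Prop := y = b ∧ y' = b ∧ x + 1 = x' ∧ a ≤ x ∧ x' ≤ a'

/-- The edges of the straight segment leading down from `(a, b)` to `(a, b')`. -/
def Down (a b b' x y x' y' : ℤ) : Prop := x = a ∧ x' = a ∧ y' + 1 = y ∧ y ≤ b ∧ b' ≤ y'

/-- The edges of the straight segment leading up from `(a, b)` to `(a, b')`. -/
def Up (a b b' x y x' y' : ℤ) : Prop := x = a ∧ x' = a ∧ y + 1 = y' ∧ b ≤ y ∧ y' ≤ b'

/-- Integer coordinates on the grid with origin `s`, in which the grid is the box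
`[x₀, x₁] × [y₀, y₁]`. -/
structure Frame (s : Fin N × Fin N) where
  x : Fin N × Fin N → ℤ
  y : Fin N × Fin N → ℤ
  x₀ : ℤ
  x₁ : ℤ
  y₀ : ℤ
  y₁ : ℤ
  inj : ∀ v w, x v = x w → y v = y w → v = w
  x_sink : x s = 0
  y_sink : y s = 0
  mem : ∀ v, x₀ ≤ x v ∧ x v ≤ x₁ ∧ y₀ ≤ y v ∧ y v ≤ y₁
  surj : ∀ a b, x₀ ≤ a → a ≤ x₁ → y₀ ≤ b → b ≤ y₁ → ∃ v, x v = a ∧ y v = b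
  adj : ∀ v w, (gridGraph N).Adj v w ↔ UnitStep (x v) (y v) (x w) (y w)
  x₀_neg : x₀ < 0
  x₁_pos : 0 < x₁
  y₀_neg : y₀ < 0
  y₁_pos : 0 < y₁
  square : x₁ - x₀ = y₁ - y₀

namespace Frame

/-- The coordinates counted from `s`, without reflections. -/
def base (hs : ¬ IsEnd s.1 ∧ ¬ IsEnd s.2) : Frame s where
  x v := v.1.val - s.1.val
  y v := v.2.val - s.2.val
  x₀ := -s.1.val
  x₁ := N - 1 - s.1.val
  y₀ := -s.2.val
  y₁ := N - 1 - s.2.val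
  inj v w h₁ h₂ := by
    ext <;> omega
  x_sink := by simp
  y_sink := by simp
  mem v := by
    have := v.1.isLt
    have := v.2.isLt
    omega
  surj a b h₁ h₂ h₃ h₄ := by
    refine ⟨(⟨(a + s.1.val).toNat, by omega⟩, ⟨(b + s.2.val).toNat, by omega⟩), ?_⟩
    dsimp only
    omega
  adj v w := by
    simp only [gridGraph, SimpleGraph.boxProd_adj, SimpleGraph.pathGraph_adj, UnitStep, Fin.ext_iff]
    omega
  x₀_neg := by have := hs.1; simp only [IsEnd] at this; omega
  x₁_pos := by have := hs.1; simp only [IsEnd] at this; omega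
  y₀_neg := by have := hs.2; simp only [IsEnd] at this; omega
  y₁_pos := by have := hs.2; simp only [IsEnd] at this; omega
  square := by ring

/-- Exchange the two coordinates. -/
def swap (F : Frame s) : Frame s where
  x := F.y
  y := F.x
  x₀ := F.y₀
  x₁ := F.y₁
  y₀ := F.x₀
  y₁ := F.x₁
  inj v w h₁ h₂ := F.inj v w h₂ h₁
  x_sink := F.y_sink
  y_sink := F.x_sink
  mem v := by have := F.mem v; omega
  surj a b h₁ h₂ h₃ h₄ := by
    obtain ⟨v, h⟩ := F.surj b a h₃ h₄ h₁ h₂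
    exact ⟨v, h.2, h.1⟩
  adj v w := by rw [F.adj]; simp only [UnitStep]; omega
  x₀_neg := F.y₀_neg
  x₁_pos := F.y₁_pos
  y₀_neg := F.x₀_neg
  y₁_pos := F.x₁_pos
  square := F.square.symm

/-- Reflect the first coordinate. -/
def reflect (F : Frame s) : Frame s where
  x v := -F.x v
  y := F.y
  x₀ := -F.x₁
  x₁ := -F.x₀
  y₀ := F.y₀
  y₁ := F.y₁
  inj v w h₁ h₂ := F.inj v w (by omega) h₂
  x_sink := by rw [F.x_sink]; rfl
  y_sink := F.y_sink
  mem v := by have := F.mem v; omega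
  surj a b h₁ h₂ h₃ h₄ := by
    obtain ⟨v, h⟩ := F.surj (-a) b (by omega) (by omega) h₃ h₄
    exact ⟨v, by omega, h.2⟩
  adj v w := by rw [F.adj]; simp only [UnitStep]; omega
  x₀_neg := by have := F.x₁_pos; omega
  x₁_pos := by have := F.x₀_neg; omega
  y₀_neg := F.y₀_neg
  y₁_pos := F.y₁_pos
  square := by have := F.square; omega

variable (F : Frame s)

/-- The edges whose end points have coordinates satisfying `Q`. -/
def edges (Q : ℤ → ℤ → ℤ → ℤ → Prop) : Set (gridGraph N).Dart :=
  {e | Q (F.x e.fst) (F.y e.fst) (F.x e.snd) (F.y e.snd)}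

/-- The indicator of `X` in coordinates. -/
noncomputable def ind (X : Set (Fin N × Fin N)) (a b : ℤ) : ℝ :=
  Set.indicator {p : ℤ × ℤ | ∃ v ∈ X, F.x v = p.1 ∧ F.y v = p.2} 1 (a, b)

theorem ind_coord (X : Set (Fin N × Fin N)) (v : Fin N × Fin N) :
    F.ind X (F.x v) (F.y v) = X.indicator 1 v := by
  by_cases hv : v ∈ X
  · rw [ind, Set.indicator_of_mem hv, Set.indicator_of_mem]
    · rfl
    · exact ⟨v, hv, rfl, rfl⟩
  · rw [ind, Set.indicator_of_notMem hv, Set.indicator_of_notMem]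
    rintro ⟨w, hw, h1, h2⟩
    exact hv (F.inj w v h1 h2 ▸ hw)

/-! ### Unit flows along straight segments -/

section Trails

variable {u τ : ℝ} {hu : 0 < u} {hτ : 0 < τ} [Fintype (gridGraph N).Dart]

/-- The edges described by `Q` carry one unit of flow from `(a, b)` to `(c, d)`. -/
def Trail (Q : ℤ → ℤ → ℤ → ℤ → Prop) (a b c d : ℤ) : Prop :=
  ∀ X : Set (Fin N × Fin N),
    (∑ e, (F.edges Q).indicator 1 e * drop X e.fst e.snd) = F.ind X a b - F.ind X c d

variable {F}

/-- Indicators of disjoint sets add up. This is where edge-disjointness of segments and of paths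
enters. -/
theorem sum_edges_or {Q Q' : ℤ → ℤ → ℤ → ℤ → Prop}
    (h : ∀ x y x' y', Q x y x' y' → ¬ Q' x y x' y') (X : Set (Fin N × Fin N)) :
    (∑ e, (F.edges fun x y x' y' => Q x y x' y' ∨ Q' x y x' y').indicator 1 e * drop X e.fst e.snd)
      = (∑ e, (F.edges Q).indicator 1 e * drop X e.fst e.snd) +
        ∑ e, (F.edges Q').indicator 1 e * drop X e.fst e.snd := by
  rw [← Finset.sum_add_distrib]
  refine Finset.sum_congr rfl fun e _ => ?_
  rw [← add_mul]
  congr 1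
  have hd : Disjoint (F.edges Q) (F.edges Q') :=
    Set.disjoint_left.2 fun e he he' => h _ _ _ _ he he'
  exact congrFun (Set.indicator_union_of_disjoint hd 1) e

theorem Trail.append {Q Q' : ℤ → ℤ → ℤ → ℤ → Prop} {a b c d a' b' : ℤ}
    (hQ : F.Trail Q a b c d) (hQ' : F.Trail Q' c d a' b')
    (h : ∀ x y x' y', Q x y x' y' → ¬ Q' x y x' y') :
    F.Trail (fun x y x' y' => Q x y x' y' ∨ Q' x y x' y') a b a' b' := by
  intro X
  rw [sum_edges_or h, hQ X, hQ' X]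
  ring

theorem Trail.congr {Q Q' : ℤ → ℤ → ℤ → ℤ → Prop} {a b c d c' d' : ℤ} (hQ : F.Trail Q a b c d)
    (h : ∀ x y x' y', Q x y x' y' ↔ Q' x y x' y') (hc : c = c') (hd : d = d') :
    F.Trail Q' a b c' d' := by
  obtain rfl : Q = Q' := by
    funext x y x' y'
    exact propext (h x y x' y')
  exact hc ▸ hd ▸ hQ

theorem trail_step {a b c d : ℤ} (h : UnitStep a b c d)
    (hab : F.x₀ ≤ a ∧ a ≤ F.x₁ ∧ F.y₀ ≤ b ∧ b ≤ F.y₁)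
    (hcd : F.x₀ ≤ c ∧ c ≤ F.x₁ ∧ F.y₀ ≤ d ∧ d ≤ F.y₁) :
    F.Trail (fun x y x' y' => x = a ∧ y = b ∧ x' = c ∧ y' = d) a b c d := by
  classical
  intro X
  obtain ⟨v, rfl, rfl⟩ := F.surj a b hab.1 hab.2.1 hab.2.2.1 hab.2.2.2
  obtain ⟨w, rfl, rfl⟩ := F.surj c d hcd.1 hcd.2.1 hcd.2.2.1 hcd.2.2.2
  let e₀ : (gridGraph N).Dart := ⟨(v, w), (F.adj v w).2 h⟩
  rw [ind_coord, ind_coord, Finset.sum_eq_single e₀]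
  · rw [Set.indicator_of_mem (by simp [edges, e₀])]
    simp [drop, e₀]
  · intro e _ he
    rw [Set.indicator_of_notMem, zero_mul]
    rintro ⟨h1, h2, h3, h4⟩
    exact he (SimpleGraph.Dart.ext _ _ (Prod.ext (F.inj _ _ h1 h2) (F.inj _ _ h3 h4)))
  · simp

theorem trail_refl (a b : ℤ) : F.Trail (fun _ _ _ _ => False) a b a b := by
  intro X
  simp [edges]

theorem trail_left {a a' b : ℤ} (h : a' ≤ a)
    (hF : F.x₀ ≤ a' ∧ a ≤ F.x₁ ∧ F.y₀ ≤ b ∧ b ≤ F.y₁) : F.Trail (Left a a' b) a b a' b := by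
  induction a', h using Int.leInductionDown with
  | base => exact (trail_refl a b).congr (by intros; simp only [false_iff, Left]; omega) rfl rfl
  | pred c hc ih =>
    exact ((ih (by omega)).append (trail_step (c := c - 1) (d := b) (by unfold UnitStep; omega)
      (by omega) (by omega)) (by unfold Left; omega)).congr
      (by intros; simp only [Left]; omega) rfl rfl

theorem trail_right {a a' b : ℤ} (h : a ≤ a')
    (hF : F.x₀ ≤ a ∧ a' ≤ F.x₁ ∧ F.y₀ ≤ b ∧ b ≤ F.y₁) : F.Trail (Right a a' b) a b a' b := by
  induction a', h using Int.leInduction with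
  | base => exact (trail_refl a b).congr (by intros; simp only [false_iff, Right]; omega) rfl rfl
  | succ c hc ih =>
    exact ((ih (by omega)).append (trail_step (c := c + 1) (d := b) (by unfold UnitStep; omega)
      (by omega) (by omega)) (by unfold Right; omega)).congr
      (by intros; simp only [Right]; omega) rfl rfl

theorem trail_down {a b b' : ℤ} (h : b' ≤ b)
    (hF : F.x₀ ≤ a ∧ a ≤ F.x₁ ∧ F.y₀ ≤ b' ∧ b ≤ F.y₁) : F.Trail (Down a b b') a b a b' := by
  induction b', h using Int.leInductionDown with
  | base => exact (trail_refl a b).congr (by intros; simp only [false_iff, Down]; omega) rfl rfl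
  | pred c hc ih =>
    exact ((ih (by omega)).append (trail_step (c := a) (d := c - 1) (by unfold UnitStep; omega)
      (by omega) (by omega)) (by unfold Down; omega)).congr
      (by intros; simp only [Down]; omega) rfl rfl

theorem trail_up {a b b' : ℤ} (h : b ≤ b')
    (hF : F.x₀ ≤ a ∧ a ≤ F.x₁ ∧ F.y₀ ≤ b ∧ b' ≤ F.y₁) : F.Trail (Up a b b') a b a b' := by
  induction b', h using Int.leInduction with
  | base => exact (trail_refl a b).congr (by intros; simp only [false_iff, Up]; omega) rfl rfl
  | succ c hc ih =>
    exact ((ih (by omega)).append (trail_step (c := a) (d := c + 1) (by unfold UnitStep; omega)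
      (by omega) (by omega)) (by unfold Up; omega)).congr
      (by intros; simp only [Up]; omega) rfl rfl

variable (F) in
/-- The edges described by `Q` carry `k` units of flow from `(a, b)` to the sink. -/
def Carries (Q : ℤ → ℤ → ℤ → ℤ → Prop) (k : ℕ) (a b : ℤ) : Prop :=
  ∀ X : Set (Fin N × Fin N), (∑ e, (F.edges Q).indicator 1 e * drop X e.fst e.snd) =
    k * (F.ind X a b - F.ind X 0 0)

theorem Trail.carries {Q : ℤ → ℤ → ℤ → ℤ → Prop} {a b c d : ℤ} (h : F.Trail Q a b c d)
    (hc : c = 0) (hd : d = 0) : F.Carries Q 1 a b := by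
  intro X
  rw [h X, hc, hd]
  simp

theorem Carries.add {Q Q' : ℤ → ℤ → ℤ → ℤ → Prop} {a b : ℤ} {k l : ℕ}
    (hQ : F.Carries Q k a b) (hQ' : F.Carries Q' l a b)
    (h : ∀ x y x' y', Q x y x' y' → ¬ Q' x y x' y') :
    F.Carries (fun x y x' y' => Q x y x' y' ∨ Q' x y x' y') (k + l) a b := by
  intro X
  rw [sum_edges_or h, hQ X, hQ' X]
  push_cast
  ring

/-- The slackness conditions are asked for all unit steps of the integer plane, not just those in
the grid, which makes them pure integer arithmetic; scaling by `τ` gives the real potential. -/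
theorem Carries.certified {v : Fin N × Fin N} {Q : ℤ → ℤ → ℤ → ℤ → Prop} {k : ℕ} {c : ℤ}
    (hQ : F.Carries Q k (F.x v) (F.y v)) (h : ℤ → ℤ → ℤ)
    (h₁ : ∀ x y x' y', UnitStep x y x' y' → Q x y x' y' → 1 ≤ h x y - h x' y')
    (h₂ : ∀ x y x' y', UnitStep x y x' y' → ¬ Q x y x' y' → h x y - h x' y' ≤ 1)
    (hc : h (F.x v) (F.y v) - h 0 0 ≤ c) :
    (gridNetwork N s u τ hu hτ).Certified v k (c * τ) := by
  refine ⟨F.edges Q, fun w => h (F.x w) (F.y w) * τ, fun e he => ?_, fun e he => ?_, ?_, ?_⟩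
  · have := h₁ _ _ _ _ ((F.adj _ _).1 e.adj) he
    have : (1 : ℝ) ≤ h (F.x e.fst) (F.y e.fst) - h (F.x e.snd) (F.y e.snd) := by exact_mod_cast this
    simp only [gridNetwork]
    nlinarith
  · have := h₂ _ _ _ _ ((F.adj _ _).1 e.adj) he
    have : (h (F.x e.fst) (F.y e.fst) : ℝ) - h (F.x e.snd) (F.y e.snd) ≤ 1 := by exact_mod_cast this
    simp only [gridNetwork]
    nlinarith
  · intro X hv (hs : s ∉ X)
    have h3 := hQ X
    have h4 := F.ind_coord X s
    rw [F.x_sink, F.y_sink] at h4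
    rw [F.ind_coord, h4, Set.indicator_of_mem hv, Set.indicator_of_notMem hs] at h3
    rw [sub_zero, Pi.one_apply, mul_one] at h3
    exact h3.ge
  · have : (h (F.x v) (F.y v) : ℝ) - h 0 0 ≤ c := by exact_mod_cast hc
    simp only [gridNetwork, F.x_sink, F.y_sink]
    nlinarith

end Trails

end Frame

/-! ### Routes to the sink and the potentials certifying them -/

/-- Two shortest paths from `(a, b)` to the origin, `a, b > 0`. -/
def Inner (a b x y x' y' : ℤ) : Prop :=
  (Left a 0 b x y x' y' ∨ Down 0 b 0 x y x' y') ∨ (Down a b 0 x y x' y' ∨ Left a 0 0 x y x' y')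

/-- A detour from `(a, b)` to the origin entering it from below. -/
def OuterRight (a b x y x' y' : ℤ) : Prop :=
  ((Right a (a + 1) b x y x' y' ∨ Down (a + 1) b (-1) x y x' y') ∨ Left (a + 1) 0 (-1) x y x' y') ∨
    Up 0 (-1) 0 x y x' y'

/-- A detour from `(a, b)` to the origin entering it from the left. -/
def OuterUp (a b x y x' y' : ℤ) : Prop :=
  ((Up a b (b + 1) x y x' y' ∨ Left a (-1) (b + 1) x y x' y') ∨ Down (-1) (b + 1) 0 x y x' y') ∨
    Right (-1) 0 0 x y x' y'

/-- The straight path from `(a, 0)` to the origin and the two paths next to it. -/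
def AxisThree (a x y x' y' : ℤ) : Prop :=
  (Left a 0 0 x y x' y' ∨
    ((Up a 0 1 x y x' y' ∨ Left a 0 1 x y x' y') ∨ Down 0 1 0 x y x' y')) ∨
    ((Down a 0 (-1) x y x' y' ∨ Left a 0 (-1) x y x' y') ∨ Up 0 (-1) 0 x y x' y')

/-- A detour from `(a, 0)` to the origin around the upper path next to the axis. -/
def Behind (a x y x' y' : ℤ) : Prop :=
  (((Right a (a + 1) 0 x y x' y' ∨ Up (a + 1) 0 2 x y x' y') ∨ Left (a + 1) (-1) 2 x y x' y') ∨
    Down (-1) 2 0 x y x' y') ∨ Right (-1) 0 0 x y x' y'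

namespace Frame

section Certificates

variable {u τ : ℝ} {hu : 0 < u} {hτ : 0 < τ} [Fintype (gridGraph N).Dart] {F : Frame s}
  {v : Fin N × Fin N} {a b : ℤ}

theorem carries_inner (ha : 0 < a) (hb : 0 < b) (hax : a ≤ F.x₁) (hby : b ≤ F.y₁) :
    F.Carries (Inner a b) 2 a b := by
  have := F.x₀_neg
  have := F.y₀_neg
  exact Carries.add (k := 1) (l := 1)
    (((trail_left (by omega) (by omega)).append (trail_down (by omega) (by omega))
      (by unfold Left Down; omega)).carries rfl rfl)
    (((trail_down (by omega) (by omega)).append (trail_left (by omega) (by omega))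
      (by unfold Left Down; omega)).carries rfl rfl) (by unfold Left Down; omega)

theorem carries_outerRight (ha : 0 < a) (hb : 0 < b) (hax : a + 1 ≤ F.x₁) (hby : b ≤ F.y₁) :
    F.Carries (OuterRight a b) 1 a b := by
  have := F.x₀_neg
  have := F.y₀_neg
  exact ((((trail_right (by omega) (by omega)).append (trail_down (by omega) (by omega))
    (by unfold Right Down; omega)).append (trail_left (by omega) (by omega))
    (by unfold Right Down Left; omega)).append (trail_up (by omega) (by omega))
    (by unfold Right Down Left Up; omega)).carries rfl rfl

theorem carries_outerUp (ha : 0 < a) (hb : 0 < b) (hax : a ≤ F.x₁) (hby : b + 1 ≤ F.y₁) :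
    F.Carries (OuterUp a b) 1 a b := by
  have := F.x₀_neg
  have := F.y₀_neg
  exact ((((trail_up (by omega) (by omega)).append (trail_left (by omega) (by omega))
    (by unfold Up Left; omega)).append (trail_down (by omega) (by omega))
    (by unfold Up Down Left; omega)).append (trail_right (by omega) (by omega))
    (by unfold Right Down Left Up; omega)).carries rfl rfl

theorem carries_axisThree (ha : 0 < a) (hax : a ≤ F.x₁) :
    F.Carries (AxisThree a) 3 a 0 := by
  have := F.x₀_neg
  have := F.y₀_neg
  have := F.y₁_pos
  exact Carries.add (k := 2) (l := 1) (Carries.add (k := 1) (l := 1)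
    ((trail_left (by omega) (by omega)).carries rfl rfl)
    ((((trail_up (by omega) (by omega)).append (trail_left (by omega) (by omega))
      (by unfold Up Left; omega)).append (trail_down (by omega) (by omega))
      (by unfold Up Down Left; omega)).carries rfl rfl)
    (by unfold Up Down Left; omega))
    ((((trail_down (by omega) (by omega)).append (trail_left (by omega) (by omega))
      (by unfold Down Left; omega)).append (trail_up (by omega) (by omega))
      (by unfold Up Down Left; omega)).carries rfl rfl)
    (by unfold Up Down Left; omega)

theorem carries_behind (ha : 0 < a) (hax : a + 1 ≤ F.x₁) (hy : 2 ≤ F.y₁) :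
    F.Carries (Behind a) 1 a 0 := by
  have := F.x₀_neg
  have := F.y₀_neg
  exact (((((trail_right (by omega) (by omega)).append (trail_up (by omega) (by omega))
    (by unfold Right Up; omega)).append (trail_left (by omega) (by omega))
    (by unfold Right Up Left; omega)).append (trail_down (by omega) (by omega))
    (by unfold Right Up Left Down; omega)).append (trail_right (by omega) (by omega))
    (by unfold Right Down Left Up; omega)).carries rfl rfl

theorem certified_two (hx : F.x v = a) (hy : F.y v = b) (ha : 0 < a) (hb : 0 < b) :
    (gridNetwork N s u τ hu hτ).Certified v 2 ((a + b : ℤ) * τ) := by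
  have hm := F.mem v
  have := carries_inner (F := F) ha hb (by omega) (by omega)
  rw [← hx, ← hy] at this
  refine this.certified (fun x y => x + y) ?_ ?_ ?_
  · unfold UnitStep Inner Left Down
    omega
  · unfold UnitStep
    omega
  · omega

/-- A potential certifying the detours from nodes off the axes. -/
def outerPotential (a b x y : ℤ) : ℤ :=
  if x = a ∧ y = b then a + b + 4 else if x = 0 ∧ y = 0 then 0 else x + y + 2

/-- The base function `x + y + 2` drops by one on steps left or down. Raising it by two at `(a, b)`
and lowering it by two at the origin makes the initial step right or up and the final step up or
right drop by exactly one; drops above one occur only on `Inner`. -/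
theorem outerPotential_of_not_inner (ha : 0 < a) (hb : 0 < b) {x y x' y' : ℤ}
    (h : UnitStep x y x' y') (hQ : ¬ Inner a b x y x' y') :
    outerPotential a b x y - outerPotential a b x' y' ≤ 1 := by
  unfold outerPotential
  unfold Inner Left Down at hQ
  rcases h with ⟨rfl, rfl | rfl⟩ | ⟨rfl, rfl | rfl⟩ <;> split_ifs <;> omega

theorem outerPotential_of_inner (ha : 0 < a) (hb : 0 < b) {x y x' y' : ℤ}
    (hQ : Inner a b x y x' y') : 1 ≤ outerPotential a b x y - outerPotential a b x' y' := by
  unfold outerPotential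
  unfold Inner Left Down at hQ
  split_ifs <;> omega

theorem outerPotential_of_outerRight (ha : 0 < a) (hb : 0 < b) {x y x' y' : ℤ}
    (hQ : OuterRight a b x y x' y') :
    1 ≤ outerPotential a b x y - outerPotential a b x' y' := by
  unfold outerPotential
  unfold OuterRight Left Down Right Up at hQ
  split_ifs <;> omega

theorem outerPotential_of_outerUp (ha : 0 < a) (hb : 0 < b) {x y x' y' : ℤ}
    (hQ : OuterUp a b x y x' y') :
    1 ≤ outerPotential a b x y - outerPotential a b x' y' := by
  unfold outerPotential
  unfold OuterUp Left Down Right Up at hQ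
  split_ifs <;> omega

theorem certified_boundary (hx : F.x v = a) (hy : F.y v = b) (ha : 0 < a) (hb : 0 < b)
    (hax : a < F.x₁) : (gridNetwork N s u τ hu hτ).Certified v 3 ((a + b + 4 : ℤ) * τ) := by
  have hm := F.mem v
  have := (carries_inner (F := F) ha hb (by omega) (by omega)).add
    (carries_outerRight (F := F) ha hb (by omega) (by omega))
    (by unfold Inner OuterRight Left Down Right Up; omega)
  rw [← hx, ← hy] at this
  refine this.certified (outerPotential a b) ?_ ?_ ?_
  · rw [hx, hy]
    rintro x y x' y' - (h | h)
    exacts [outerPotential_of_inner ha hb h, outerPotential_of_outerRight ha hb h]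
  · rw [hx, hy]
    exact fun x y x' y' h hQ => outerPotential_of_not_inner ha hb h fun h => hQ (Or.inl h)
  · unfold outerPotential
    split_ifs <;> omega

theorem certified_interior (hx : F.x v = a) (hy : F.y v = b) (ha : 0 < a) (hb : 0 < b)
    (hax : a < F.x₁) (hby : b < F.y₁) :
    (gridNetwork N s u τ hu hτ).Certified v 4 ((a + b + 4 : ℤ) * τ) := by
  have hm := F.mem v
  have := ((carries_inner (F := F) ha hb (by omega) (by omega)).add
    (carries_outerRight (F := F) ha hb (by omega) (by omega))
    (by unfold Inner OuterRight Left Down Right Up; omega)).add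
    (carries_outerUp (F := F) ha hb (by omega) (by omega))
    (by unfold Inner OuterRight OuterUp Left Down Right Up; omega)
  rw [← hx, ← hy] at this
  refine this.certified (outerPotential a b) ?_ ?_ ?_
  · rw [hx, hy]
    rintro x y x' y' - ((h | h) | h)
    exacts [outerPotential_of_inner ha hb h, outerPotential_of_outerRight ha hb h,
      outerPotential_of_outerUp ha hb h]
  · rw [hx, hy]
    exact fun x y x' y' h hQ =>
      outerPotential_of_not_inner ha hb h fun h => hQ (Or.inl (Or.inl h))
  · unfold outerPotential
    split_ifs <;> omega

theorem certified_axisThree (hx : F.x v = a) (hy : F.y v = 0) (ha : 0 < a) :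
    (gridNetwork N s u τ hu hτ).Certified v 3 ((a + 2 : ℤ) * τ) := by
  have hm := F.mem v
  have := carries_axisThree (F := F) ha (by omega)
  rw [← hx, ← hy] at this
  refine this.certified
    -- Vertical edges are used only at the two ends, so a function of `x` alone serves between them;
    -- the extra one at each end pays for those edges.
    (fun x y => if x = a ∧ y = 0 then a + 2 else if x = 0 ∧ y = 0 then 0 else x + 1) ?_ ?_ ?_
  · rw [hx]
    intro x y x' y' h hQ
    unfold AxisThree Left Down Up at hQ
    split_ifs <;> omega
  · rw [hx]
    intro x y x' y' h hQ
    unfold AxisThree Left Down Up at hQ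
    rcases h with ⟨rfl, rfl | rfl⟩ | ⟨rfl, rfl | rfl⟩ <;> split_ifs <;> omega
  · split_ifs <;> omega

/-- A potential certifying the detour from a node on an axis. -/
def behindPotential (a x y : ℤ) : ℤ :=
  if x = a ∧ y = 0 then a + 8 else if x = 0 ∧ y = 0 then 0 else
    if x < a then x + 4 - max 0 (2 - |y|) else x + 4 + max 0 (2 - |y|)

/-- The three paths fill the rows `|y| ≤ 1`, so a fourth must use row `2`. The term `max 0 (2 -
|y|)` makes the potential fall away from the axis for `x ≥ a` and towards it for `x < a`, as the
detour requires; the larger jumps between the two regimes lie on `AxisThree`. -/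
theorem behindPotential_of_not_axisThree (ha : 0 < a) {x y x' y' : ℤ}
    (h : UnitStep x y x' y') (hQ : ¬ AxisThree a x y x' y') :
    behindPotential a x y - behindPotential a x' y' ≤ 1 := by
  unfold behindPotential
  unfold AxisThree Left Down Up at hQ
  simp only [abs_eq_max_neg]
  rcases h with ⟨rfl, rfl | rfl⟩ | ⟨rfl, rfl | rfl⟩ <;> split_ifs <;> omega

theorem behindPotential_of_axisThree (ha : 0 < a) {x y x' y' : ℤ}
    (hQ : AxisThree a x y x' y') : 1 ≤ behindPotential a x y - behindPotential a x' y' := by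
  unfold behindPotential
  unfold AxisThree Left Down Up at hQ
  simp only [abs_eq_max_neg]
  split_ifs <;> omega

theorem behindPotential_of_behind (ha : 0 < a) {x y x' y' : ℤ}
    (hQ : Behind a x y x' y') : 1 ≤ behindPotential a x y - behindPotential a x' y' := by
  unfold behindPotential
  unfold Behind Left Right Down Up at hQ
  simp only [abs_eq_max_neg]
  split_ifs <;> omega

theorem certified_axisFour (hx : F.x v = a) (hy : F.y v = 0) (ha : 0 < a) (hax : a < F.x₁)
    (hF : 2 ≤ F.y₁) : (gridNetwork N s u τ hu hτ).Certified v 4 ((a + 8 : ℤ) * τ) := by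
  have hm := F.mem v
  have := (carries_axisThree (F := F) ha (by omega)).add
    (carries_behind (F := F) ha (by omega) (by omega))
    (by unfold AxisThree Behind Left Down Right Up; omega)
  rw [← hx, ← hy] at this
  refine this.certified (behindPotential a) ?_ ?_ ?_
  · rw [hx]
    rintro x y x' y' - (h | h)
    exacts [behindPotential_of_axisThree ha h, behindPotential_of_behind ha h]
  · rw [hx]
    exact fun x y x' y' h hQ => behindPotential_of_not_axisThree ha h fun h => hQ (Or.inl h)
  · unfold behindPotential
    split_ifs <;> omega

end Certificates

end Frame

/-! ### Distances in the grid -/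

/-- The number of grid edges on a shortest path from `v` to `s`. -/
def manhattan (s v : Fin N × Fin N) : ℤ := |(v.1.val : ℤ) - s.1.val| + |(v.2.val : ℤ) - s.2.val|

section Distance

variable {u τ : ℝ} {hu : 0 < u} {hτ : 0 < τ}

theorem manhattan_adj {v w : Fin N × Fin N} (h : (gridGraph N).Adj v w) :
    manhattan s v ≤ 1 + manhattan s w := by
  simp only [gridGraph, SimpleGraph.boxProd_adj, SimpleGraph.pathGraph_adj, Fin.ext_iff] at h
  unfold manhattan
  simp only [abs_eq_max_neg]
  omega

theorem feasible_manhattan :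
    (gridNetwork N s u τ hu hτ).Feasible 0 fun v => (manhattan s v : ℝ) * τ := by
  rintro (e | e) he
  · have : (manhattan s e.fst : ℝ) ≤ 1 + manhattan s e.snd := by
      exact_mod_cast manhattan_adj e.adj
    simp only [gridNetwork, arcTail, arcHead, arcCost]
    nlinarith
  · simp [Residual] at he

theorem exists_adj_manhattan {v : Fin N × Fin N} {n : ℕ} (h : manhattan s v = n + 1) :
    ∃ w, (gridGraph N).Adj v w ∧ manhattan s w = n := by
  obtain ⟨⟨i, hi⟩, ⟨j, hj⟩⟩ := v
  obtain ⟨⟨k, hk⟩, ⟨l, hl⟩⟩ := s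
  simp only [manhattan, abs_eq_max_neg] at h
  have key : ∃ i' j' : ℕ, ∃ hi' : i' < N, ∃ hj' : j' < N,
      ((i + 1 = i' ∨ i' + 1 = i) ∧ j = j' ∨ (j + 1 = j' ∨ j' + 1 = j) ∧ i = i') ∧
        max ((i' : ℤ) - k) (-((i' : ℤ) - k)) + max ((j' : ℤ) - l) (-((j' : ℤ) - l)) = n := by
    rcases lt_trichotomy i k with hik | rfl | hik
    · exact ⟨i + 1, j, by omega, hj, by omega, by omega⟩
    · rcases lt_trichotomy j l with hjl | rfl | hjl
      · exact ⟨i, j + 1, hi, by omega, by omega, by omega⟩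
      · omega
      · exact ⟨i, j - 1, hi, by omega, by omega, by omega⟩
    · exact ⟨i - 1, j, by omega, hj, by omega, by omega⟩
  obtain ⟨i', j', hi', hj', hadj, hm⟩ := key
  refine ⟨(⟨i', hi'⟩, ⟨j', hj'⟩), ?_, by simpa only [manhattan, abs_eq_max_neg] using hm⟩
  simpa only [gridGraph, SimpleGraph.boxProd_adj, SimpleGraph.pathGraph_adj, Fin.ext_iff] using hadj

theorem exists_walk_manhattan (n : ℕ) : ∀ v, manhattan s v = n →
    ∃ l, (gridNetwork N s u τ hu hτ).IsWalk 0 v l ∧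
      (l.map (gridNetwork N s u τ hu hτ).arcCost).sum = n * τ := by
  induction n with
  | zero =>
    intro v hv
    refine ⟨[], ?_, by simp⟩
    simp only [manhattan, abs_eq_max_neg] at hv
    change v = s
    ext <;> omega
  | succ n ih =>
    intro v hv
    obtain ⟨w, hvw, hw⟩ := exists_adj_manhattan hv
    obtain ⟨l, hl, hlc⟩ := ih w hw
    refine ⟨Sum.inl ⟨(v, w), hvw⟩ :: l, ⟨hu, rfl, hl⟩, ?_⟩
    rw [List.map_cons, List.sum_cons, hlc]
    simp only [arcCost, gridNetwork]
    push_cast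
    ring

theorem exists_path_manhattan (v : Fin N × Fin N) :
    ∃ P : ArcPath (Fin N × Fin N) (gridGraph N).Dart, P.origin = v ∧
      (gridNetwork N s u τ hu hτ).IsPath 0 P ∧
      (gridNetwork N s u τ hu hτ).cost P ≤ manhattan s v * τ := by
  have h0 : 0 ≤ manhattan s v := add_nonneg (abs_nonneg _) (abs_nonneg _)
  obtain ⟨n, hn⟩ := Int.eq_ofNat_of_zero_le h0
  obtain ⟨l, hl, hlc⟩ := exists_walk_manhattan (hu := hu) (hτ := hτ) n v hn
  obtain ⟨P, hP, hP', hPc⟩ := feasible_manhattan.exists_path hl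
  refine ⟨P, hP, hP', hPc.trans ?_⟩
  rw [hlc, hn]
  simp

theorem manhattan_sink : ((manhattan s s : ℤ) : ℝ) * τ = 0 := by simp [manhattan]

theorem distToSink_grid (v : Fin N × Fin N) :
    (gridNetwork N s u τ hu hτ).distToSink v = manhattan s v * τ :=
  distToSink_eq (π := fun v => (manhattan s v : ℝ) * τ) feasible_manhattan manhattan_sink
    exists_path_manhattan v

end Distance

/-! ### Certificates for the regions -/

/-- Reflections bring any node into the first quadrant. -/
theorem exists_frame (hs : ¬ IsEnd s.1 ∧ ¬ IsEnd s.2) (v : Fin N × Fin N) :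
    ∃ F : Frame s, 0 ≤ F.x v ∧ 0 ≤ F.y v ∧ F.x v + F.y v = manhattan s v ∧
      (F.x v = 0 ↔ v.1 = s.1) ∧ (F.y v = 0 ↔ v.2 = s.2) ∧
      (F.x v = F.x₁ ↔ IsEnd v.1) ∧ (F.y v = F.y₁ ↔ IsEnd v.2) := by
  have hs' := hs
  have h1 := v.1.isLt
  have h2 := v.2.isLt
  simp only [IsEnd] at hs'
  by_cases hx : s.1.val ≤ v.1.val <;> by_cases hy : s.2.val ≤ v.2.val
  · refine ⟨Frame.base hs, ?_⟩
    simp only [Frame.base, manhattan, IsEnd, Fin.ext_iff, abs_eq_max_neg]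
    omega
  -- Conjugation by the exchange of coordinates reflects the second one. Since `s` is not at an end,
  -- a coordinate that is now nonnegative can be extreme only at the upper end.
  · refine ⟨(Frame.base hs).swap.reflect.swap, ?_⟩
    simp only [Frame.base, Frame.swap, Frame.reflect, manhattan, IsEnd, Fin.ext_iff,
      abs_eq_max_neg]
    omega
  · refine ⟨(Frame.base hs).reflect, ?_⟩
    simp only [Frame.base, Frame.reflect, manhattan, IsEnd, Fin.ext_iff, abs_eq_max_neg]
    omega
  · refine ⟨(Frame.base hs).reflect.swap.reflect.swap, ?_⟩
    simp only [Frame.base, Frame.swap, Frame.reflect, manhattan, IsEnd, Fin.ext_iff,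
      abs_eq_max_neg]
    omega

/-- A node on an axis other than the sink can be brought to the first half of the first axis. -/
theorem exists_frame_axis (hs : ¬ IsEnd s.1 ∧ ¬ IsEnd s.2) {v : Fin N × Fin N} (hvs : v ≠ s)
    (hv : OnAxis s v) : ∃ F : Frame s, 0 < F.x v ∧ F.y v = 0 ∧ F.x v = manhattan s v ∧
      (F.x v = F.x₁ → IsEnd v.1 ∨ IsEnd v.2) := by
  obtain ⟨F, hx, hy, hm, hx0, hy0, hx1, hy1⟩ := exists_frame hs v
  have hne : ¬ (F.x v = 0 ∧ F.y v = 0) := fun h => hvs (Prod.ext (hx0.1 h.1) (hy0.1 h.2))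
  rcases hv with hv | hv
  · have := hx0.2 hv
    exact ⟨F.swap, by simp only [Frame.swap]; omega, this, by simp only [Frame.swap]; omega,
      fun h => Or.inr (hy1.1 h)⟩
  · have := hy0.2 hv
    exact ⟨F, by omega, this, by omega, fun h => Or.inl (hx1.1 h)⟩

section Regions

variable {u τ : ℝ} {hu : 0 < u} {hτ : 0 < τ} [Fintype (gridGraph N).Dart] {v : Fin N × Fin N}

theorem certified_two_of_not_onAxis (hs : ¬ IsEnd s.1 ∧ ¬ IsEnd s.2) (hv : ¬ OnAxis s v) :
    (gridNetwork N s u τ hu hτ).Certified v 2 (manhattan s v * τ) := by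
  obtain ⟨F, hx, hy, hm, hx0, hy0, -, -⟩ := exists_frame hs v
  obtain ⟨hv1, hv2⟩ := not_or.1 hv
  rw [← hx0] at hv1
  rw [← hy0] at hv2
  rw [← hm]
  exact F.certified_two rfl rfl (by omega) (by omega)

theorem certified_of_mem_C1 (hs : ¬ IsEnd s.1 ∧ ¬ IsEnd s.2) (hv : v ∈ C1 s) :
    (gridNetwork N s u τ hu hτ).Certified v 4 ((manhattan s v + 4 : ℤ) * τ) := by
  obtain ⟨F, hx, hy, hm, hx0, hy0, hx1, hy1⟩ := exists_frame hs v
  obtain ⟨h1, h2, h3⟩ := hv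
  obtain ⟨hv1, hv2⟩ := not_or.1 h1
  have := F.mem v
  rw [← hx0] at hv1
  rw [← hy0] at hv2
  rw [← hx1] at h2
  rw [← hy1] at h3
  rw [← hm]
  exact F.certified_interior rfl rfl (by omega) (by omega) (by omega) (by omega)

theorem certified_of_mem_C2 (hs : ¬ IsEnd s.1 ∧ ¬ IsEnd s.2) (hv : v ∈ C2 s) :
    (gridNetwork N s u τ hu hτ).Certified v 3 ((manhattan s v + 4 : ℤ) * τ) := by
  obtain ⟨F, hx, hy, hm, hx0, hy0, hx1, hy1⟩ := exists_frame hs v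
  obtain ⟨h1, h2⟩ := hv
  obtain ⟨hv1, hv2⟩ := not_or.1 h1
  have := F.mem v
  rw [← hx0] at hv1
  rw [← hy0] at hv2
  -- The detour needs room beyond the node in the first direction; if only the second has room, the
  -- coordinates are exchanged.
  rcases h2 with ⟨-, h2⟩ | ⟨-, h2⟩
  · rw [← hy1] at h2
    rw [← hm, add_comm (F.x v)]
    exact F.swap.certified_boundary rfl rfl (by omega) (by omega)
      (by dsimp only [Frame.swap]; omega)
  · rw [← hx1] at h2
    rw [← hm]
    exact F.certified_boundary rfl rfl (by omega) (by omega) (by omega)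

theorem certified_three_of_onAxis (hs : ¬ IsEnd s.1 ∧ ¬ IsEnd s.2) (hvs : v ≠ s)
    (hv : OnAxis s v) :
    (gridNetwork N s u τ hu hτ).Certified v 3 ((manhattan s v + 2 : ℤ) * τ) := by
  obtain ⟨F, hx, hy, hm, -⟩ := exists_frame_axis hs hvs hv
  rw [← hm]
  exact F.certified_axisThree rfl hy hx

theorem certified_of_mem_X1 (hs : ¬ IsEnd s.1 ∧ ¬ IsEnd s.2) (hv : v ∈ X1 s) :
    (gridNetwork N s u τ hu hτ).Certified v 4 ((manhattan s v + 8 : ℤ) * τ) := by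
  obtain ⟨F, hx, hy, hm, hx1⟩ := exists_frame_axis hs hv.1 hv.2.1
  have hmem := F.mem v
  have hlt : F.x v < F.x₁ :=
    lt_of_le_of_ne hmem.2.1 fun h => (hx1 h).elim hv.2.2.1 hv.2.2.2
  have := F.x₀_neg
  have := F.square
  rw [← hm]
  -- Here `x₁ ≥ 2` and `x₀ ≤ -1`, so the square has side at least three and there are two free rows
  -- on one side of the axis; if not above, reflect.
  by_cases h2 : 2 ≤ F.y₁
  · exact F.certified_axisFour rfl hy hx hlt h2
  · exact F.swap.reflect.swap.certified_axisFour rfl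
      (by simp only [Frame.swap, Frame.reflect]; omega) hx hlt
      (by simp only [Frame.swap, Frame.reflect]; omega)

end Regions

end Grid

theorem mainTheorem8 (N : ℕ) (s : Fin N × Fin N)
    (hs : ¬ Grid.IsEnd s.1 ∧ ¬ Grid.IsEnd s.2)
    (u τ : ℝ) (hu : 0 < u) (hτ : 0 < τ)
    (ρ : (gridNetwork N s u τ hu hτ).TieBreakingRule)
    (p : ℕ) (hp : 1 ≤ p) (hp4 : p ≤ 4)
    (v : Fin p → Fin N × Fin N)
    (hv : ∀ i, v i ∈ (gridNetwork N s u τ hu hτ).sources)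
    (hadm : ∃ A ⊆ (gridNetwork N s u τ hu hτ).sources, ρ.Admits A v) :
    let d : Fin N × Fin N → ℝ := (gridNetwork N s u τ hu hτ).distToSink
    let v₁ : Fin N × Fin N := v ⟨0, hp⟩
    (v₁ ∈ Grid.C1 s → ∃ h : 4 ≤ p,
      (ρ.KeepsOrigin → v₁ = v ⟨1, by omega⟩) ∧
      d (v ⟨2, by omega⟩) ≤ d v₁ + 4 * τ ∧
      d (v ⟨3, by omega⟩) ≤ d v₁ + 4 * τ) ∧
    (v₁ ∈ Grid.C2 s → ∃ h : 3 ≤ p,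
      (ρ.KeepsOrigin → v₁ = v ⟨1, by omega⟩) ∧
      d (v ⟨2, by omega⟩) ≤ d v₁ + 4 * τ) ∧
    (v₁ ∈ Grid.C3 s → ∃ h : 2 ≤ p,
      (ρ.KeepsOrigin → v₁ = v ⟨1, by omega⟩)) ∧
    (v₁ ∈ Grid.X1 s → ∃ h : 4 ≤ p,
      d (v ⟨1, by omega⟩) ≤ d v₁ + 2 * τ ∧
      d (v ⟨2, by omega⟩) ≤ d v₁ + 2 * τ ∧
      d (v ⟨3, by omega⟩) ≤ d v₁ + 8 * τ) ∧
    (v₁ ∈ Grid.X2 s → ∃ h : 3 ≤ p,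
      d (v ⟨1, by omega⟩) ≤ d v₁ + 2 * τ ∧
      d (v ⟨2, by omega⟩) ≤ d v₁ + 2 * τ) := by

  -- Net outflow is a finite sum over edges, so some enumeration of them is fixed.
  obtain ⟨_⟩ : Nonempty (Fintype (gridGraph N).Dart) := by
    classical exact ⟨inferInstance⟩
  intro d v₁
  obtain ⟨A, hA, hadm⟩ := hadm
  have hd : ∀ x, d x = Grid.manhattan s x * τ := Grid.distToSink_grid
  have hkeep : ¬ Grid.OnAxis s v₁ → ∀ h : 1 < p, ρ.KeepsOrigin → v₁ = v ⟨1, h⟩ :=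
    fun hax h hρ => (Grid.certified_two_of_not_onAxis hs hax).keepsOrigin
      (π := fun v => (Grid.manhattan s v : ℝ) * τ) hρ hA hadm h Grid.feasible_manhattan
      Grid.manhattan_sink Grid.exists_path_manhattan
  have hbound : ∀ {k : ℕ} {c : ℤ},
      (gridNetwork N s u τ hu hτ).Certified v₁ k ((Grid.manhattan s v₁ + c : ℤ) * τ) →
      k ≤ p ∧ ∀ i (hi : i < p), i < k → d (v ⟨i, hi⟩) ≤ d v₁ + c * τ := by
    intro k c hc
    have := hc.admits hadm hp Grid.feasible_manhattan Grid.manhattan_sink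
    refine ⟨this.1, fun i hi hik => ?_⟩
    rw [hd, hd, ← add_mul]
    exact_mod_cast this.2 i hi hik
  refine ⟨fun h => ?_, fun h => ?_, fun h => ?_, fun h => ?_, fun h => ?_⟩
  · obtain ⟨h4, hb⟩ := hbound (Grid.certified_of_mem_C1 hs h)
    exact ⟨h4, hkeep h.1 _, by simpa using hb 2 (by omega) (by omega),
      by simpa using hb 3 (by omega) (by omega)⟩
  · obtain ⟨h3, hb⟩ := hbound (Grid.certified_of_mem_C2 hs h)
    exact ⟨h3, hkeep h.1 _, by simpa using hb 2 (by omega) (by omega)⟩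
  · have h2 := ((Grid.certified_two_of_not_onAxis hs h.1).admits hadm hp Grid.feasible_manhattan
      Grid.manhattan_sink).1
    exact ⟨h2, hkeep h.1 _⟩
  · obtain ⟨h4, hb⟩ := hbound (Grid.certified_of_mem_X1 hs h)
    -- The sharper bound `2 * τ` for the second and third origins needs the three-path certificate;
    -- the four-path one only gives `8 * τ`.
    obtain ⟨-, hb'⟩ := hbound (Grid.certified_three_of_onAxis hs h.1 h.2.1)
    exact ⟨h4, by simpa using hb' 1 (by omega) (by omega),
      by simpa using hb' 2 (by omega) (by omega), by simpa using hb 3 (by omega) (by omega)⟩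
  · obtain ⟨h3, hb⟩ := hbound (Grid.certified_three_of_onAxis hs h.1 h.2.1)
    exact ⟨h3, by simpa using hb 1 (by omega) (by omega),
      by simpa using hb 2 (by omega) (by omega)⟩
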